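/- Let $\mathbb D$ be the open unit disc and let $0<p<\infty$. Let $f$ be analytic on $\mathbb D$, not identically zero, and in the Hardy space $H^p$, that is, $$\sup_{0<r<1}\frac1{2\pi}\int_0^{2\pi}|f(re^{i\theta})|^p\,d\theta<\infty .$$ Let $a_0\in\mathbb C$ and $r_0>0$ be such that $\overline{D(a_0,r_0)}=\{z:|z-a_0|\le r_0\}\subset\mathbb D$. Then the zeros $(z_n)$ of $f$ in $\mathbb D$, repeated according to multiplicity, satisfy $\sum_n(1-|z_n|)<\infty$. Let $C_1$ be the Blaschke factor of $f$, i.e. the (finite or infinite) convergent product $$C_1(z)=\prod_n B_{z_n}(z)\quad(z\in\mathbb D),\qquad B_0(z)=z,\qquad B_a(z)=\frac{-\overline a}{|a|}\,\frac{z-a}{1-\overline a z}\quad(0<|a|<1).$$ For all $\delta>0$ and $\varepsilon>0$ there exist a constant $c_0\in\mathbb C$ and a finite Blaschke product $$C_2(z)=u\prod_{j=1}^N\frac{z-b_j}{1-\overline{b_j}z},\qquad |u|=1,\quad N\ge 1,$$ all of whose zeros $b_j$ lie on the circle $\{z:|z-a_0|=r_0\}$, such that $$|f(z)-c_0\,C_1(z)\,C_2(z)|<\varepsilon\qquad\text{whenever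 } |z-a_0|<r_0-\delta .$$ -/

import Mathlib

open Metric Set
open scoped ComplexConjugate

noncomputable section

/-- `f` belongs to the Hardy space `H^p` of the open unit disc: it is analytic there and the means
`(1 / 2π) ∫ |f (r e^{iθ})|^p dθ`, `0 < r < 1`, are bounded. -/
def MemHardy (p : ℝ) (f : ℂ → ℂ) : Prop :=
  AnalyticOnNhd ℂ f (ball 0 1) ∧
    BddAbove ((fun r : ℝ => Real.circleAverage (fun z : ℂ => ‖f z‖ ^ p) 0 r) '' Ioo 0 1)

/-- The index set of the zeros of `f` in the open unit disc, each zero being repeated according to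
its multiplicity. -/
abbrev ZeroIndex (f : ℂ → ℂ) : Type :=
  Σ a : {a : ℂ // a ∈ ball (0 : ℂ) 1 ∧ f a = 0}, Fin (analyticOrderNatAt f (a : ℂ))

/-- The zeros of `f` in the open unit disc, repeated according to multiplicity, as a family. -/
def zeroFamily (f : ℂ → ℂ) (i : ZeroIndex f) : ℂ := (i.1 : ℂ)

/-- A Blaschke sequence: points of the open unit disc with `∑ (1 - |a i|) < ∞`. -/
def IsBlaschkeFamily {ι : Type} (a : ι → ℂ) : Prop :=
  (∀ i, ‖a i‖ < 1) ∧ Summable fun i => 1 - ‖a i‖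

/-- One factor of a Blaschke product, with its usual normalization: `z` for the zero `a = 0`,
and `(-conj a / |a|) * (z - a) / (1 - conj a * z)` for `a ≠ 0`. -/
def blaschkeTerm (a z : ℂ) : ℂ :=
  if a = 0 then z else (-conj a / (‖a‖ : ℂ)) * ((z - a) / (1 - conj a * z))

/-- `C` is the Blaschke factor of `f`: the zeros of `f` in the open unit disc, repeated according
to multiplicity, form a Blaschke sequence, and on the disc `C` is the (finite or infinite,
convergent) Blaschke product with exactly these zeros. -/
def IsBlaschkeFactor (f C : ℂ → ℂ) : Prop :=
  IsBlaschkeFamily (zeroFamily f) ∧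
    ∀ z ∈ ball (0 : ℂ) 1, HasProd (fun i => blaschkeTerm (zeroFamily f i) z) (C z)

/-- `B` is the finite Blaschke product `z ↦ u * ∏ j, (z - b j) / (1 - conj (b j) * z)`,
where `|u| = 1`, whose zeros are the points `b j` of the open unit disc. -/
def IsFiniteBlaschkeProduct {N : ℕ} (b : Fin N → ℂ) (B : ℂ → ℂ) : Prop :=
  (∀ j, ‖b j‖ < 1) ∧ ∃ u : ℂ, ‖u‖ = 1 ∧
    ∀ z ∈ ball (0 : ℂ) 1, B z = u * ∏ j, (z - b j) / (1 - conj (b j) * z)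

end

/-!
Jensen's formula, together with `p log |f| ≤ |f| ^ p`, bounds the sum of `log (1 / |a|)` over the
zeros `a ≠ 0` of `f` (`sum_order_mul_log_inv_le`), so the Blaschke product `C₁` of the zeros converges
(`IsBlaschkeFamily.hasProd`), and `f = C₁ g` with `g` analytic and zero-free in the disc
(`exists_eq_blaschkeProduct_mul`). As `C₁` is bounded on the compact disc `|z - a₀| ≤ r₀`, it remains
to approximate `g` by constant multiples of finite Blaschke products with zeros on the circle
(`exists_blaschke_approx`).

An automorphism of the unit disc carries the circle `|z - a₀| = r₀` to a circle `|w| = ρ`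
(`exists_pseudohyperbolic_disc`) and Blaschke factors to Blaschke factors, up to constants. For
`|b| = ρ` the denominator `1 - conj b * w` equals `(b - ρ² w) / b`, so a finite Blaschke product with
zeros on `|w| = ρ` is, up to a constant, `P w / P (ρ² w)`, where `P` is a polynomial with all its
roots on that circle. After scaling to the unit circle, two facts finish the proof:

* a zero-free `F` is approximated by `F 0 * q z / q (s z)` with `q z = ∏ k < m, F (s ^ k z)`, because
  the quotient telescopes to `F z / F (s ^ m z)` (`exists_telescoping_quotient`);
* the zero-free `q` is approximated by a Taylor polynomial `t`, and `t` by `t + z ^ m t*`, where `t*` is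
  the conjugate-reversed polynomial; all roots of this sum lie on the unit circle, by the maximum
  principle (`norm_eq_one_of_isRoot`).
-/

/-! ### Convergence of Blaschke products -/

theorem one_sub_conj_mul_ne_zero {a z : ℂ} (ha : ‖a‖ ≤ 1) (hz : ‖z‖ < 1) : 1 - conj a * z ≠ 0 := by
  intro h
  have h1 : conj a * z = 1 := (sub_eq_zero.1 h).symm
  have h2 : ‖a‖ * ‖z‖ = 1 := by simpa using congrArg norm h1
  nlinarith [norm_nonneg a, norm_nonneg z]

theorem blaschkeTerm_ne_zero {a z : ℂ} (ha : ‖a‖ < 1) (hz : ‖z‖ < 1) (h : a ≠ z) :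
    blaschkeTerm a z ≠ 0 := by
  unfold blaschkeTerm
  split_ifs with h0
  · rw [← h0]; exact h.symm
  · exact mul_ne_zero (div_ne_zero (by simpa using h0) (by simpa using h0))
      (div_ne_zero (sub_ne_zero.2 h.symm) (one_sub_conj_mul_ne_zero ha.le hz))

theorem differentiableOn_blaschkeTerm {a : ℂ} (ha : ‖a‖ < 1) :
    DifferentiableOn ℂ (blaschkeTerm a) (ball 0 1) := by
  unfold blaschkeTerm
  split_ifs with h0
  · exact differentiableOn_id
  · refine (DifferentiableOn.div (by fun_prop) (by fun_prop) fun z hz => ?_).const_mul _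
    exact one_sub_conj_mul_ne_zero ha.le (by simpa using hz)

/-- The estimate behind the convergence of Blaschke products: for `a ≠ 0`,
`1 - blaschkeTerm a z = (1 - |a|) (|a| + conj a * z) / (|a| (1 - conj a * z))`. -/
theorem norm_blaschkeTerm_sub_one_le {a z : ℂ} (ha : ‖a‖ < 1) (hz : ‖z‖ < 1) :
    ‖blaschkeTerm a z - 1‖ ≤ (1 - ‖a‖) * (2 / (1 - ‖z‖)) := by
  have hz' : 0 < 1 - ‖z‖ := by linarith
  unfold blaschkeTerm
  split_ifs with h0
  · subst h0
    have h1 : ‖z - 1‖ ≤ 2 := (norm_sub_le _ _).trans (by simp; linarith)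
    have h2 : 2 ≤ 2 / (1 - ‖z‖) := by
      rw [le_div_iff₀ hz']; nlinarith [norm_nonneg z]
    simpa using h1.trans h2
  · have hna : (‖a‖ : ℂ) ≠ 0 := by simpa using h0
    have hna' : 0 < ‖a‖ := by simpa using h0
    have hne := one_sub_conj_mul_ne_zero ha.le hz
    have hmul : conj a * a = (‖a‖ : ℂ) ^ 2 := by
      rw [mul_comm, Complex.mul_conj, Complex.normSq_eq_norm_sq]; push_cast; ring
    have key : -conj a / (‖a‖ : ℂ) * ((z - a) / (1 - conj a * z)) - 1 =
        ((‖a‖ : ℂ) - 1) * (‖a‖ + conj a * z) / (‖a‖ * (1 - conj a * z)) := by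
      field_simp
      linear_combination hmul
    have hn1 : ‖(‖a‖ : ℂ) - 1‖ = 1 - ‖a‖ := by
      rw [← Complex.ofReal_one, ← Complex.ofReal_sub, Complex.norm_real, Real.norm_eq_abs,
        abs_of_neg (by linarith)]; ring
    have hn2 : ‖(‖a‖ : ℂ) + conj a * z‖ ≤ 2 * ‖a‖ := by
      refine (norm_add_le _ _).trans ?_
      simp only [norm_mul, RCLike.norm_conj, Complex.norm_real, norm_norm]
      nlinarith
    have hn3 : 1 - ‖z‖ ≤ ‖1 - conj a * z‖ := by
      have := norm_sub_norm_le (1 : ℂ) (conj a * z)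
      simp only [norm_mul, RCLike.norm_conj, norm_one] at this
      nlinarith [norm_nonneg z]
    rw [key, norm_div, norm_mul, norm_mul, hn1, Complex.norm_real, norm_norm, mul_div_assoc]
    refine mul_le_mul_of_nonneg_left ?_ (by linarith)
    calc _ ≤ 2 * ‖a‖ / (‖a‖ * (1 - ‖z‖)) := by gcongr
      _ = _ := by field_simp

theorem IsBlaschkeFamily.hasProd {ι : Type} {a : ι → ℂ} (ha : IsBlaschkeFamily a) {z : ℂ}
    (hz : z ∈ ball (0 : ℂ) 1) :
    HasProd (fun i => blaschkeTerm (a i) z) (∏' i, blaschkeTerm (a i) z) := by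
  have hz' : ‖z‖ < 1 := by simpa using hz
  have hs : Summable fun i => ‖blaschkeTerm (a i) z - 1‖ :=
    (ha.2.mul_right (2 / (1 - ‖z‖))).of_nonneg_of_le (fun _ => norm_nonneg _)
      fun i => norm_blaschkeTerm_sub_one_le (ha.1 i) hz'
  simpa using (multipliable_one_add_of_summable hs).hasProd

theorem IsBlaschkeFamily.tprod_ne_zero {ι : Type} {a : ι → ℂ} (ha : IsBlaschkeFamily a) {z : ℂ}
    (hz : z ∈ ball (0 : ℂ) 1) (h : ∀ i, a i ≠ z) : ∏' i, blaschkeTerm (a i) z ≠ 0 := by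
  have hz' : ‖z‖ < 1 := by simpa using hz
  have hs : Summable fun i => ‖blaschkeTerm (a i) z - 1‖ :=
    (ha.2.mul_right (2 / (1 - ‖z‖))).of_nonneg_of_le (fun _ => norm_nonneg _)
      fun i => norm_blaschkeTerm_sub_one_le (ha.1 i) hz'
  simpa using tprod_one_add_ne_zero_of_summable (f := fun i => blaschkeTerm (a i) z - 1)
    (fun i => by simpa using blaschkeTerm_ne_zero (ha.1 i) hz' (h i)) hs

theorem IsBlaschkeFamily.differentiableOn_tprod {ι : Type} {a : ι → ℂ} (ha : IsBlaschkeFamily a) :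
    DifferentiableOn ℂ (fun z => ∏' i, blaschkeTerm (a i) z) (ball 0 1) := by
  intro z hz
  have hz' : ‖z‖ < 1 := by simpa using hz
  obtain ⟨r, hzr, hr1⟩ := exists_between hz'
  have hsub : ball (0 : ℂ) r ⊆ ball 0 1 := ball_subset_ball hr1.le
  have hloc := Summable.hasProdLocallyUniformlyOn_one_add (K := ball (0 : ℂ) r)
    (f := fun i z => blaschkeTerm (a i) z - 1) isOpen_ball (ha.2.mul_right (2 / (1 - r)))
    (Filter.Eventually.of_forall fun i w hw => by
      have hw' : ‖w‖ < r := by simpa using hw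
      refine (norm_blaschkeTerm_sub_one_le (ha.1 i) (hw'.trans hr1)).trans ?_
      have := ha.1 i
      gcongr)
    (fun i => ((differentiableOn_blaschkeTerm (ha.1 i)).continuousOn.mono hsub).sub
      continuousOn_const)
  simp only [add_sub_cancel] at hloc
  have := hloc.differentiableOn (Filter.Eventually.of_forall fun s =>
    DifferentiableOn.fun_finsetProd fun i _ =>
      (differentiableOn_blaschkeTerm (ha.1 i)).mono hsub) isOpen_ball
  exact (this.differentiableAt (isOpen_ball.mem_nhds (by simpa using hzr))).differentiableWithinAt

/-! ### The Blaschke condition and division by the Blaschke product -/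

section

open scoped Topology

theorem analyticOrderAt_ne_top_of_exists_ne_zero {f : ℂ → ℂ}
    (hf : AnalyticOnNhd ℂ f (ball 0 1)) (hf0 : ∃ z ∈ ball (0 : ℂ) 1, f z ≠ 0) {w : ℂ}
    (hw : w ∈ ball (0 : ℂ) 1) : analyticOrderAt f w ≠ ⊤ := fun h => by
  obtain ⟨z, hz, hz0⟩ := hf0
  exact hz0 (hf.eqOn_zero_of_preconnected_of_eventuallyEq_zero
    (convex_ball _ _).isPreconnected hw (analyticOrderAt_eq_top.1 h) hz)

/-- If the circle averages of `log |f|` are bounded above, Jensen's formula bounds the sums of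
`log (1 / |a|)` over the nonzero zeros `a` of `f`. A zero at the origin contributes nothing here,
because `Real.log 0⁻¹ = 0`. -/
theorem sum_order_mul_log_inv_le {f : ℂ → ℂ} (hf : AnalyticOnNhd ℂ f (ball 0 1))
    (hf0 : ∃ z ∈ ball (0 : ℂ) 1, f z ≠ 0) {A : ℝ}
    (hA : ∀ r ∈ Ioo (0 : ℝ) 1, Real.circleAverage (Real.log ‖f ·‖) 0 r ≤ A)
    {s : Finset ℂ} (hs : ∀ a ∈ s, a ∈ ball (0 : ℂ) 1) :
    ∑ a ∈ s, (analyticOrderNatAt f a : ℝ) * Real.log ‖a‖⁻¹ ≤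
      A - Real.log ‖meromorphicTrailingCoeffAt f 0‖ := by
  set L := Real.log ‖meromorphicTrailingCoeffAt f 0‖ with hL
  -- Jensen's formula bounds the corresponding sum on each circle of radius `r < 1`
  have hev : ∀ᶠ r in 𝓝[<] (1 : ℝ), ∑ a ∈ s, (analyticOrderNatAt f a : ℝ) * Real.log (r * ‖a‖⁻¹) ≤
      A - L - analyticOrderNatAt f 0 * Real.log r := by
    have h1 : ∀ᶠ r in 𝓝[<] (1 : ℝ), ∀ a ∈ s, ‖a‖ < r := by
      rw [Filter.eventually_all_finset]
      exact fun a ha => eventually_nhdsWithin_of_eventually_nhds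
        (eventually_gt_nhds (by simpa using hs a ha))
    filter_upwards [h1, Ioo_mem_nhdsLT (zero_lt_one (α := ℝ))] with r hr hr01
    have hr0 := hr01.1
    have hsub : closedBall (0 : ℂ) |r| ⊆ ball 0 1 := by
      rw [abs_of_pos hr0]; exact closedBall_subset_ball hr01.2
    have hfr : AnalyticOnNhd ℂ f (closedBall 0 |r|) := hf.mono hsub
    have hdiv : ∀ u ∈ closedBall (0 : ℂ) |r|,
        (MeromorphicOn.divisor f (closedBall 0 |r|) u : ℝ) = analyticOrderNatAt f u := fun u hu => by
      rw [MeromorphicOn.AnalyticOnNhd.divisor_apply hfr hu, ← Nat.cast_analyticOrderNatAt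
        (analyticOrderAt_ne_top_of_exists_ne_zero hf hf0 (hsub hu))]
      simp
    have hjen := MeromorphicOn.circleAverage_log_norm hr0.ne' hfr.meromorphicOn
    rw [hdiv 0 (by simp), ← hL] at hjen
    have hle := hA r hr01
    rw [hjen] at hle
    set T : ℂ → ℝ := fun u => (MeromorphicOn.divisor f (closedBall 0 |r|) u : ℝ) *
      Real.log (r * ‖0 - u‖⁻¹) with hT
    have hT0 : ∀ u, 0 ≤ T u := fun u => by
      by_cases hu : u ∈ closedBall (0 : ℂ) |r|
      · simp only [hT, hdiv u hu, zero_sub, norm_neg]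
        refine mul_nonneg (Nat.cast_nonneg _) ?_
        rcases eq_or_ne u 0 with rfl | hu0
        · simp
        · refine Real.log_nonneg ?_
          rw [← div_eq_mul_inv, one_le_div (norm_pos_iff.2 hu0)]
          simpa [abs_of_pos hr0] using hu
      · simp [hT, MeromorphicOn.divisor_def, hu]
    have hTfin : T.support.Finite :=
      ((MeromorphicOn.divisor f (closedBall 0 |r|)).finiteSupport
        (isCompact_closedBall 0 |r|)).subset fun u hu h => hu (by simp [hT, h])
    classical
    have hsum : ∑ a ∈ s, (analyticOrderNatAt f a : ℝ) * Real.log (r * ‖a‖⁻¹) ≤ ∑ᶠ u, T u := by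
      rw [finsum_eq_sum_of_support_subset (s := hTfin.toFinset ∪ s) T (by simp)]
      calc _ = ∑ a ∈ s, T a := Finset.sum_congr rfl fun a ha => by
            simp only [hT, zero_sub, norm_neg]
            rw [hdiv a (by simpa [abs_of_pos hr0] using (hr a ha).le)]
        _ ≤ _ := Finset.sum_le_sum_of_subset_of_nonneg Finset.subset_union_right
          fun u _ _ => hT0 u
    linarith
  refine le_of_tendsto_of_tendsto (b := 𝓝[<] (1 : ℝ)) ?_ ?_ hev
  · refine tendsto_finsetSum _ fun a _ => Filter.Tendsto.const_mul _ ?_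
    rcases eq_or_ne a 0 with rfl | ha
    · simp
    · have : ContinuousAt (fun r : ℝ => Real.log (r * ‖a‖⁻¹)) 1 :=
        ContinuousAt.log (by fun_prop) (by simpa using ha)
      simpa using this.tendsto.mono_left nhdsWithin_le_nhds
  · have : ContinuousAt (fun r : ℝ => A - L - analyticOrderNatAt f 0 * Real.log r) 1 :=
      continuousAt_const.sub (continuousAt_const.mul (Real.continuousAt_log one_ne_zero))
    simpa using this.tendsto.mono_left nhdsWithin_le_nhds

/-- Boundedness of the circle averages of `log |f|` gives the Blaschke condition, as
`1 - |a| ≤ log (1 / |a|)`; a zero at the origin is counted separately. -/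
theorem isBlaschkeFamily_zeroFamily {f : ℂ → ℂ} (hf : AnalyticOnNhd ℂ f (ball 0 1))
    (hf0 : ∃ z ∈ ball (0 : ℂ) 1, f z ≠ 0) {A : ℝ}
    (hA : ∀ r ∈ Ioo (0 : ℝ) 1, Real.circleAverage (Real.log ‖f ·‖) 0 r ≤ A) :
    IsBlaschkeFamily (zeroFamily f) := by
  have hlt : ∀ i, ‖zeroFamily f i‖ < 1 := fun i => mem_ball_zero_iff.1 i.1.2.1
  refine ⟨hlt, (summable_sigma_of_nonneg fun i => by linarith [hlt i]).2
    ⟨fun a => (hasSum_fintype _).summable, ?_⟩⟩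
  simp only [zeroFamily, tsum_fintype, Finset.sum_const, Finset.card_univ, Fintype.card_fin,
    nsmul_eq_mul]
  refine summable_of_sum_le (c := analyticOrderNatAt f 0 +
    (A - Real.log ‖meromorphicTrailingCoeffAt f 0‖)) (fun a => ?_) fun s => ?_
  · have : ‖(a : ℂ)‖ < 1 := by simpa using a.2.1
    exact mul_nonneg (Nat.cast_nonneg _) (by linarith)
  classical
  set s' : Finset ℂ := s.map (Function.Embedding.subtype _) with hs'
  have hs'b : ∀ a ∈ s', a ∈ ball (0 : ℂ) 1 := fun a ha => by
    obtain ⟨b, -, rfl⟩ := Finset.mem_map.1 ha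
    exact b.2.1
  have hterm : ∀ a : ℂ, (analyticOrderNatAt f a : ℝ) * (1 - ‖a‖) ≤
      (if a = 0 then (analyticOrderNatAt f 0 : ℝ) else 0) +
        analyticOrderNatAt f a * Real.log ‖a‖⁻¹ := fun a => by
    split_ifs with h
    · simp [h]
    · rw [zero_add, Real.log_inv]
      refine mul_le_mul_of_nonneg_left ?_ (Nat.cast_nonneg _)
      linarith [Real.log_le_sub_one_of_pos (norm_pos_iff.2 h)]
  calc _ = ∑ a ∈ s', (analyticOrderNatAt f a : ℝ) * (1 - ‖a‖) := by simp [hs']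
    _ ≤ ∑ a ∈ s', ((if a = 0 then (analyticOrderNatAt f 0 : ℝ) else 0) +
        analyticOrderNatAt f a * Real.log ‖a‖⁻¹) := Finset.sum_le_sum fun a _ => hterm a
    _ ≤ _ := by
      rw [Finset.sum_add_distrib]
      refine add_le_add ?_ (sum_order_mul_log_inv_le hf hf0 hA hs'b)
      rw [Finset.sum_ite_eq']
      split_ifs <;> simp

/-- For `f` in `H^p` the averages of `log |f|` are bounded above, since `p log |f| ≤ |f| ^ p`. -/
theorem MemHardy.exists_circleAverage_log_le {p : ℝ} (hp : 0 < p) {f : ℂ → ℂ} (hf : MemHardy p f) :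
    ∃ A, ∀ r ∈ Ioo (0 : ℝ) 1, Real.circleAverage (Real.log ‖f ·‖) 0 r ≤ A := by
  obtain ⟨hfa, M, hM⟩ := hf
  refine ⟨p⁻¹ * M, fun r hr => ?_⟩
  have hsub : sphere (0 : ℂ) |r| ⊆ ball 0 1 := by
    rw [abs_of_pos hr.1]
    exact sphere_subset_closedBall.trans (closedBall_subset_ball hr.2)
  have hint1 : CircleIntegrable (Real.log ‖f ·‖) 0 r :=
    (hfa.mono hsub).meromorphicOn.circleIntegrable_log_norm
  have hint2 : CircleIntegrable (p⁻¹ • fun z => ‖f z‖ ^ p) 0 r := by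
    refine ContinuousOn.circleIntegrable' ?_
    exact ((hfa.continuousOn.mono hsub).norm.rpow_const fun _ _ => Or.inr hp.le).const_smul _
  refine (Real.circleAverage_mono hint1 hint2 fun z _ => ?_).trans ?_
  · rw [Pi.smul_apply, smul_eq_mul, ← div_eq_inv_mul]
    rcases eq_or_ne (f z) 0 with h | h
    · simp [h, Real.zero_rpow hp.ne']
    · rw [le_div_iff₀ hp, mul_comm, ← Real.log_rpow (norm_pos_iff.2 h)]
      exact Real.log_le_self (by positivity)
  · rw [Real.circleAverage_smul, smul_eq_mul]
    exact mul_le_mul_of_nonneg_left (hM (mem_image_of_mem _ hr)) (by positivity)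

theorem exists_blaschkeTerm_eq_sub_mul {w : ℂ} (hw : ‖w‖ < 1) :
    ∃ h : ℂ → ℂ, AnalyticAt ℂ h w ∧ h w ≠ 0 ∧ ∀ z, blaschkeTerm w z = (z - w) * h z := by
  rcases eq_or_ne w 0 with rfl | h0
  · exact ⟨fun _ => 1, analyticAt_const, one_ne_zero, fun z => by simp [blaschkeTerm]⟩
  · have hne := one_sub_conj_mul_ne_zero hw.le hw
    refine ⟨fun z => -conj w / (‖w‖ : ℂ) / (1 - conj w * z), ?_, ?_, fun z => ?_⟩
    · exact AnalyticAt.div (by fun_prop) (by fun_prop) hne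
    · exact div_ne_zero (div_ne_zero (by simpa using h0) (by simpa using h0)) hne
    · rw [blaschkeTerm, if_neg h0]; ring

/-- Each point of the disc occurs in the family of zeros as often as its multiplicity. -/
theorem zeroFamily_fiber {f : ℂ → ℂ} {w : ℂ} (hw : w ∈ ball (0 : ℂ) 1) :
    Finite {i | zeroFamily f i = w} ∧
      Nat.card {i | zeroFamily f i = w} = analyticOrderNatAt f w := by
  let e : Fin (analyticOrderNatAt f w) → {i | zeroFamily f i = w} := fun j =>
    ⟨⟨⟨w, hw, apply_eq_zero_of_analyticOrderNatAt_ne_zero (Nat.ne_zero_of_lt j.2)⟩, j⟩, rfl⟩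
  have he : Function.Bijective e := by
    refine ⟨fun j k h => eq_of_heq (Sigma.mk.inj (Subtype.mk.inj h)).2, ?_⟩
    rintro ⟨⟨⟨a, ha⟩, j⟩, h⟩
    obtain rfl : a = w := h
    exact ⟨j, rfl⟩
  exact ⟨Finite.of_surjective e he.2, by simpa using (Nat.card_eq_of_bijective e he).symm⟩

/-- The Blaschke product formed with the zeros of `f` has the same zeros as `f`, with the same
multiplicities: near `w` split off the finitely many factors that vanish at `w`; the product of the
others is again a Blaschke product and does not vanish at `w`. -/
theorem analyticOrderAt_blaschkeProduct {f : ℂ → ℂ} (hb : IsBlaschkeFamily (zeroFamily f)) {w : ℂ}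
    (hw : w ∈ ball (0 : ℂ) 1) :
    analyticOrderAt (fun z => ∏' i, blaschkeTerm (zeroFamily f i) z) w =
      analyticOrderNatAt f w := by
  have han : ∀ {ι : Type} {a : ι → ℂ}, IsBlaschkeFamily a →
      AnalyticAt ℂ (fun z => ∏' i, blaschkeTerm (a i) z) w := fun h =>
    h.differentiableOn_tprod.analyticAt (isOpen_ball.mem_nhds hw)
  set s : Set (ZeroIndex f) := {i | zeroFamily f i = w} with hs
  obtain ⟨hfin, hcard⟩ := zeroFamily_fiber (f := f) hw
  have hbc : IsBlaschkeFamily fun i : (sᶜ : Set (ZeroIndex f)) => zeroFamily f i :=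
    ⟨fun i => hb.1 i, hb.2.subtype _⟩
  obtain ⟨h, hh, hh0, hterm⟩ := exists_blaschkeTerm_eq_sub_mul (w := w) (by simpa using hw)
  rw [(han hb).analyticOrderAt_eq_natCast]
  refine ⟨fun z => h z ^ analyticOrderNatAt f w *
    ∏' i : (sᶜ : Set (ZeroIndex f)), blaschkeTerm (zeroFamily f i) z,
    (hh.pow _).mul (han hbc), mul_ne_zero (pow_ne_zero _ hh0) (hbc.tprod_ne_zero hw fun i => i.2),
    ?_⟩
  filter_upwards [isOpen_ball.mem_nhds hw] with z hz
  have hfib : HasProd ((fun i => blaschkeTerm (zeroFamily f i) z) ∘ ((↑) : s → ZeroIndex f))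
      (blaschkeTerm w z ^ analyticOrderNatAt f w) := by
    have : Fintype s := Fintype.ofFinite s
    have hconst : ((fun i => blaschkeTerm (zeroFamily f i) z) ∘ ((↑) : s → ZeroIndex f)) =
        fun _ => blaschkeTerm w z := funext fun i => by
      have : zeroFamily f i = w := i.2
      simp [this]
    rw [hconst, ← hcard, Nat.card_eq_fintype_card]
    simpa using hasProd_fintype fun _ : s => blaschkeTerm w z
  rw [(hfib.mul_compl (hbc.hasProd hz)).tprod_eq, hterm, mul_pow, smul_eq_mul, mul_assoc]

/-- Dividing `f` by its Blaschke product leaves a zero-free analytic function. -/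
theorem exists_eq_blaschkeProduct_mul {f : ℂ → ℂ} (hf : AnalyticOnNhd ℂ f (ball 0 1))
    (hf0 : ∃ z ∈ ball (0 : ℂ) 1, f z ≠ 0) (hb : IsBlaschkeFamily (zeroFamily f)) :
    ∃ g : ℂ → ℂ, DifferentiableOn ℂ g (ball 0 1) ∧ (∀ z ∈ ball (0 : ℂ) 1, g z ≠ 0) ∧
      ∀ z ∈ ball (0 : ℂ) 1, f z = (∏' i, blaschkeTerm (zeroFamily f i) z) * g z := by
  set B : ℂ → ℂ := fun z => ∏' i, blaschkeTerm (zeroFamily f i) z with hB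
  have hBa : AnalyticOnNhd ℂ B (ball 0 1) := hb.differentiableOn_tprod.analyticOnNhd isOpen_ball
  have hord : ∀ w ∈ ball (0 : ℂ) 1, analyticOrderAt f w = analyticOrderAt B w := fun w hw => by
    rw [hB, analyticOrderAt_blaschkeProduct hb hw, Nat.cast_analyticOrderNatAt
      (analyticOrderAt_ne_top_of_exists_ne_zero hf hf0 hw)]
  have hmer : MeromorphicOn (f / B) (ball 0 1) := hf.meromorphicOn.div hBa.meromorphicOn
  have hordq : ∀ w ∈ ball (0 : ℂ) 1, meromorphicOrderAt (f / B) w = 0 := fun w hw => by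
    rw [meromorphicOrderAt_div (hf w hw).meromorphicAt (hBa w hw).meromorphicAt,
      (hf w hw).meromorphicOrderAt_eq, (hBa w hw).meromorphicOrderAt_eq, ← hord w hw,
      ← Nat.cast_analyticOrderNatAt (analyticOrderAt_ne_top_of_exists_ne_zero hf hf0 hw)]
    simp
  set g := toMeromorphicNFOn (f / B) (ball 0 1) with hg
  have hgnf : MeromorphicNFOn g (ball 0 1) := meromorphicNFOn_toMeromorphicNFOn _ _
  have hgord : ∀ w ∈ ball (0 : ℂ) 1, meromorphicOrderAt g w = 0 := fun w hw => by
    rw [← hordq w hw]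
    exact meromorphicOrderAt_congr (hmer.toMeromorphicNFOn_eq_self_on_nhdsNE hw)
  have hga : ∀ w ∈ ball (0 : ℂ) 1, AnalyticAt ℂ g w := fun w hw =>
    (hgnf hw).meromorphicOrderAt_nonneg_iff_analyticAt.1 (hgord w hw).ge
  refine ⟨g, fun w hw => (hga w hw).differentiableAt.differentiableWithinAt,
    fun w hw => (hgnf hw).meromorphicOrderAt_eq_zero_iff.1 (hgord w hw), fun w hw => ?_⟩
  -- the identity holds off the zeros of `B`, hence everywhere by continuity
  have hBne : ∀ᶠ z in 𝓝[≠] w, B z ≠ 0 := by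
    refine (hBa w hw).eventually_eq_zero_or_eventually_ne_zero.resolve_left fun h => ?_
    exact analyticOrderAt_ne_top_of_exists_ne_zero hf hf0 hw
      ((hord w hw).trans (analyticOrderAt_eq_top.2 h))
  have hev : f =ᶠ[𝓝[≠] w] fun z => B z * g z := by
    filter_upwards [hBne, hmer.toMeromorphicNFOn_eq_self_on_nhdsNE hw] with z hz1 hz2
    rw [hg, hz2, Pi.div_apply, mul_div_cancel₀ _ hz1]
  exact (((hf w hw).continuousAt.eventuallyEq_nhds_iff_eventuallyEq_nhdsNE
    ((hBa w hw).mul (hga w hw)).continuousAt).1 hev).eq_of_nhds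

end

/-! ### Polynomials with all roots on the unit circle -/

section

open Polynomial

/-- The conjugate-reversed polynomial `t*` satisfies `t*(w) = w ^ deg t * conj (t (1 / conj w))`.
Here `v` is the reflection of `w` in the unit circle. -/
theorem eval_reverse_map_conj (t : ℂ[X]) {v w : ℂ} (hv : v * conj w = 1) :
    (t.map (starRingEnd ℂ)).reverse.eval w = w ^ t.natDegree * conj (t.eval v) := by
  have hw : w ≠ 0 := by rintro rfl; simp at hv
  have hv' : conj v = w⁻¹ := by
    exact eq_inv_of_mul_eq_one_left (by simpa using congrArg conj hv)
  let : Invertible (conj v) := invertibleOfNonzero (by rw [hv']; exact inv_ne_zero hw)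
  have h := eval₂_reverse_mul_pow (RingHom.id ℂ) (conj v) (t.map (starRingEnd ℂ))
  rw [natDegree_map, invOf_eq_inv, hv', inv_inv, ← hv', ← eval_map, Polynomial.map_id,
    eval₂_id, eval_map, eval₂_hom] at h
  rw [← h, hv', mul_comm _ ((w⁻¹) ^ _), ← mul_assoc, ← mul_pow, mul_inv_cancel₀ hw, one_pow, one_mul]

/-- `|t*| ≤ |t|` on the closed disc by the maximum principle, as `|t*| = |t|` on the circle. -/
theorem norm_reverse_map_conj_eval_le {t : ℂ[X]} (ht : ∀ z ∈ closedBall (0 : ℂ) 1, t.eval z ≠ 0)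
    {z : ℂ} (hz : z ∈ closedBall (0 : ℂ) 1) :
    ‖(t.map (starRingEnd ℂ)).reverse.eval z‖ ≤ ‖t.eval z‖ := by
  set R := (t.map (starRingEnd ℂ)).reverse with hR
  have hcl : closure (ball (0 : ℂ) 1) = closedBall 0 1 := closure_ball _ one_ne_zero
  have hd : DiffContOnCl ℂ (fun z => R.eval z / t.eval z) (ball 0 1) := by
    refine ⟨DifferentiableOn.div R.differentiable.differentiableOn
      t.differentiable.differentiableOn fun z hz => ht z (ball_subset_closedBall hz), ?_⟩
    rw [hcl]
    exact R.continuous.continuousOn.div t.continuous.continuousOn ht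
  have := Complex.norm_le_of_forall_mem_frontier_norm_le isBounded_ball hd (C := 1)
    (fun w hw => by
      rw [frontier_ball _ one_ne_zero, mem_sphere_zero_iff_norm] at hw
      have hww : w * conj w = 1 := by
        rw [Complex.mul_conj, Complex.normSq_eq_norm_sq, hw]; simp
      rw [hR, eval_reverse_map_conj t hww, norm_div, norm_mul, norm_pow, hw, one_pow, one_mul,
        RCLike.norm_conj]
      exact div_self_le_one _) (hcl ▸ hz)
  rwa [norm_div, div_le_one (norm_pos_iff.2 (ht z hz))] at this

/-- If `t` is zero-free on the closed unit disc, then all roots of `t + z ^ m t*` lie on the unit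
circle: `|z ^ m t*| < |t|` in the open disc, and the reverse strict inequality holds outside the
closed disc by reflection. -/
theorem norm_eq_one_of_isRoot {t : ℂ[X]} (ht : ∀ z ∈ closedBall (0 : ℂ) 1, t.eval z ≠ 0)
    {m : ℕ} (hm : 0 < m) {w : ℂ}
    (hw : (t + X ^ m * (t.map (starRingEnd ℂ)).reverse).eval w = 0) : ‖w‖ = 1 := by
  simp only [eval_add, eval_mul, eval_pow, eval_X] at hw
  rcases lt_trichotomy ‖w‖ 1 with h | h | h
  · exfalso
    have hwb : w ∈ closedBall (0 : ℂ) 1 := by simpa using h.le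
    have h1 : ‖t.eval w‖ = ‖w‖ ^ m * ‖(t.map (starRingEnd ℂ)).reverse.eval w‖ := by
      rw [eq_neg_of_add_eq_zero_left hw]; simp
    have h2 := norm_reverse_map_conj_eval_le ht hwb
    have h3 : 0 < ‖t.eval w‖ := norm_pos_iff.2 (ht w hwb)
    have h4 : ‖w‖ ^ m < 1 := pow_lt_one₀ (norm_nonneg _) h hm.ne'
    have h5 : ‖w‖ ^ m * ‖(t.map (starRingEnd ℂ)).reverse.eval w‖ ≤ ‖w‖ ^ m * ‖t.eval w‖ := by
      gcongr
    nlinarith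
  · exact h
  · exfalso
    have hw0 : w ≠ 0 := norm_pos_iff.1 (zero_lt_one.trans h)
    -- the reflection of `w` in the unit circle
    set v : ℂ := (conj w)⁻¹ with hv
    have hcw : conj w ≠ 0 := by simpa using hw0
    have hvn : ‖v‖ = ‖w‖⁻¹ := by simp [hv]
    have hvb : v ∈ closedBall (0 : ℂ) 1 := by
      simpa [hvn] using inv_le_one_of_one_le₀ h.le
    have e1 := eval_reverse_map_conj t (v := v) (w := w) (by rw [hv, inv_mul_cancel₀ hcw])
    have e2 := eval_reverse_map_conj t (v := w) (w := v) (by rw [hv]; simp [hw0])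
    have h2 := norm_reverse_map_conj_eval_le ht hvb
    have h3 : 0 < ‖t.eval v‖ := norm_pos_iff.2 (ht v hvb)
    have h1 : ‖t.eval w‖ = ‖w‖ ^ m * (‖w‖ ^ t.natDegree * ‖t.eval v‖) := by
      rw [eq_neg_of_add_eq_zero_left hw, e1]; simp
    rw [e2, norm_mul, norm_pow, RCLike.norm_conj, h1, hvn] at h2
    have h5 : (‖w‖⁻¹) ^ t.natDegree * (‖w‖ ^ m * (‖w‖ ^ t.natDegree * ‖t.eval v‖)) =
        ‖w‖ ^ m * ‖t.eval v‖ := by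
      have : (‖w‖⁻¹) ^ t.natDegree * ‖w‖ ^ t.natDegree = 1 := by
        rw [← mul_pow, inv_mul_cancel₀ (by simpa using hw0), one_pow]
      linear_combination (‖w‖ ^ m * ‖t.eval v‖) * this
    have h4 : 1 < ‖w‖ ^ m := one_lt_pow₀ h hm.ne'
    rw [h5] at h2
    nlinarith

theorem natDegree_add_X_pow_mul_reverse_pos {t : ℂ[X]} (ht : t.eval 0 ≠ 0)
    {m : ℕ} (hm : 0 < m) : 0 < (t + X ^ m * (t.map (starRingEnd ℂ)).reverse).natDegree := by
  have h0 : t ≠ 0 := by rintro rfl; simp at ht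
  have h1 : (t.map (starRingEnd ℂ)).reverse.natDegree = t.natDegree := by
    rw [reverse_natDegree, natDegree_map, natTrailingDegree_eq_zero.2, Nat.sub_zero]
    right; simpa [coeff_zero_eq_eval_zero] using ht
  have h2 : (X ^ m * (t.map (starRingEnd ℂ)).reverse).natDegree = m + t.natDegree := by
    rw [natDegree_mul (pow_ne_zero _ X_ne_zero) (by
      simpa using (Polynomial.map_ne_zero_iff (starRingEnd ℂ).injective).2 h0), h1, natDegree_X_pow]
  rw [natDegree_add_eq_right_of_natDegree_lt] <;> omega

/-- A function that is analytic on a neighbourhood of the closed unit disc and zero-free there is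
a uniform limit, on smaller discs, of polynomials with all roots on the unit circle: add to a Taylor
polynomial `t` the term `z ^ m t*`, which is small inside the disc when `m` is large. -/
theorem exists_polynomial_roots_on_circle {q : ℂ → ℂ} {R : ℝ} (hR : 1 < R)
    (hq : DifferentiableOn ℂ q (ball 0 R)) (hq0 : ∀ z ∈ closedBall (0 : ℂ) 1, q z ≠ 0)
    {r : ℝ} (hr1 : r < 1) {η : ℝ} (hη : 0 < η) :
    ∃ S : ℂ[X], 0 < S.natDegree ∧ (∀ w, S.eval w = 0 → ‖w‖ = 1) ∧
      ∀ z ∈ closedBall (0 : ℂ) r, ‖S.eval z - q z‖ < η := by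
  have hK : IsCompact (closedBall (0 : ℂ) 1) := isCompact_closedBall _ _
  have hsub : closedBall (0 : ℂ) 1 ⊆ ball 0 R := closedBall_subset_ball hR
  obtain ⟨κ, hκ, hκ'⟩ := hK.exists_forall_le' (f := fun z => ‖q z‖) (a := 0)
    (hq.continuousOn.mono hsub).norm fun z hz => norm_pos_iff.2 (hq0 z hz)
  -- a Taylor polynomial of `q`
  obtain ⟨R', hR'1, hR'R⟩ := exists_between hR
  obtain ⟨R'', hR''1, hR''R⟩ := exists_between hR'1
  lift R' to NNReal using by linarith
  lift R'' to NNReal using by linarith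
  have hps := (hq.mono (closedBall_subset_ball hR'R)).hasFPowerSeriesOnBall (R := R')
    (by exact_mod_cast zero_lt_one.trans hR'1)
  have hunif := hps.tendstoUniformlyOn' (r' := R'') (by exact_mod_cast hR''R)
  rw [Metric.tendstoUniformlyOn_iff] at hunif
  obtain ⟨n, hn⟩ := (hunif (min κ (η / 2)) (lt_min hκ (half_pos hη))).exists
  set p := cauchyPowerSeries q 0 R' with hp
  set t : ℂ[X] := ∑ k ∈ Finset.range n, C (p.coeff k) * X ^ k with ht
  have hteval : ∀ z, t.eval z = p.partialSum n (z - 0) := fun z => by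
    rw [ht, eval_finsetSum, FormalMultilinearSeries.partialSum, sub_zero]
    refine Finset.sum_congr rfl fun k _ => ?_
    rw [FormalMultilinearSeries.apply_eq_pow_smul_coeff, eval_mul, eval_C, eval_pow, eval_X,
      smul_eq_mul, mul_comm]
  have htq : ∀ z ∈ closedBall (0 : ℂ) 1, ‖t.eval z - q z‖ < min κ (η / 2) := fun z hz => by
    have := hn z (closedBall_subset_ball hR''1 hz)
    rwa [dist_comm, dist_eq_norm, ← hteval] at this
  have ht0 : ∀ z ∈ closedBall (0 : ℂ) 1, t.eval z ≠ 0 := fun z hz h => by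
    have h1 := (htq z hz).trans_le (min_le_left _ _)
    rw [h, zero_sub, norm_neg] at h1
    exact absurd (hκ' z hz) (not_le.2 h1)
  obtain ⟨M, hM⟩ := hK.exists_bound_of_continuousOn (f := fun z => t.eval z)
    t.continuous.continuousOn
  have hM0 : 0 ≤ M := (norm_nonneg _).trans (hM 0 (by simp))
  obtain ⟨m, hm⟩ := exists_pow_lt_of_lt_one (y := max r 0) (x := η / 2 / (M + 1))
    (by positivity) (by simpa using hr1)
  refine ⟨t + X ^ (m + 1) * (t.map (starRingEnd ℂ)).reverse,
    natDegree_add_X_pow_mul_reverse_pos (ht0 0 (by simp)) m.succ_pos,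
    fun w => norm_eq_one_of_isRoot ht0 m.succ_pos, fun z hz => ?_⟩
  have hzr : ‖z‖ ≤ r := by simpa using hz
  have hz1 : z ∈ closedBall (0 : ℂ) 1 := closedBall_subset_closedBall hr1.le hz
  have h1 : ‖z ^ (m + 1) * (t.map (starRingEnd ℂ)).reverse.eval z‖ ≤ η / 2 := by
    rw [norm_mul, norm_pow]
    have h2 := (norm_reverse_map_conj_eval_le ht0 hz1).trans (hM z hz1)
    have h3 : ‖z‖ ^ (m + 1) ≤ η / 2 / (M + 1) := by
      refine le_trans ?_ hm.le
      calc ‖z‖ ^ (m + 1) ≤ ‖z‖ ^ m :=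
            pow_le_pow_of_le_one (norm_nonneg _) (hzr.trans hr1.le) m.le_succ
        _ ≤ _ := by gcongr; exact hzr.trans (le_max_left _ _)
    calc _ ≤ η / 2 / (M + 1) * M := by gcongr
      _ ≤ η / 2 / (M + 1) * (M + 1) := by gcongr; linarith
      _ = η / 2 := by field_simp
  calc _ = ‖(t.eval z - q z) + z ^ (m + 1) * (t.map (starRingEnd ℂ)).reverse.eval z‖ := by
        simp only [eval_add, eval_mul, eval_pow, eval_X]; ring_nf
    _ ≤ _ := norm_add_le _ _
    _ < η / 2 + η / 2 := add_lt_add_of_lt_of_le ((htq z hz1).trans_le (min_le_right _ _)) h1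
    _ = η := by ring

/-! ### Approximation on the unit disc -/

/-- A quantitative form of the continuity of division. -/
theorem norm_div_sub_div_lt {κ M ε : ℝ} (hκ : 0 < κ) (hM : 0 < M) (hε : 0 < ε)
    {x y X Y : ℂ} (hxM : ‖x‖ ≤ M) (hyM : ‖y‖ ≤ M) (hyκ : κ ≤ ‖y‖)
    (hX : ‖X - x‖ < min (κ / 2) (ε * κ ^ 2 / (8 * M)))
    (hY : ‖Y - y‖ < min (κ / 2) (ε * κ ^ 2 / (8 * M))) :
    Y ≠ 0 ∧ ‖X / Y - x / y‖ < ε := by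
  have hy0 : y ≠ 0 := norm_pos_iff.1 (hκ.trans_le hyκ)
  have hYκ : κ / 2 ≤ ‖Y‖ := by
    have h1 := norm_sub_norm_le y Y
    rw [norm_sub_rev] at h1
    have := hY.trans_le (min_le_left _ _)
    linarith
  have hY0 : Y ≠ 0 := norm_pos_iff.1 ((half_pos hκ).trans_le hYκ)
  refine ⟨hY0, ?_⟩
  have key : X / Y - x / y = ((X - x) * y - x * (Y - y)) / (Y * y) := by field_simp; ring
  have hX' := (hX.trans_le (min_le_right _ _)).le
  have hY' := (hY.trans_le (min_le_right _ _)).le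
  have hnum : ‖(X - x) * y - x * (Y - y)‖ ≤ ε * κ ^ 2 / 4 := by
    calc _ ≤ ‖X - x‖ * ‖y‖ + ‖x‖ * ‖Y - y‖ := by simpa using norm_sub_le ((X - x) * y) (x * (Y - y))
      _ ≤ ε * κ ^ 2 / (8 * M) * M + M * (ε * κ ^ 2 / (8 * M)) := by gcongr
      _ = _ := by field_simp; ring
  have hden : κ ^ 2 / 2 ≤ ‖Y * y‖ := by
    rw [norm_mul]
    calc κ ^ 2 / 2 = κ / 2 * κ := by ring
      _ ≤ _ := by gcongr
  rw [key, norm_div]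
  calc _ ≤ (ε * κ ^ 2 / 4) / (κ ^ 2 / 2) := by gcongr
    _ = ε / 2 := by field_simp; ring
    _ < ε := half_lt_self hε

theorem exists_eval_eq_prod_fin {S : ℂ[X]} (hS : 0 < S.natDegree) :
    ∃ (N : ℕ) (b : Fin N → ℂ), 0 < N ∧ (∀ j, S.eval (b j) = 0) ∧
      ∀ z, S.eval z = S.leadingCoeff * ∏ j, (z - b j) := by
  have hS0 : S ≠ 0 := by rintro rfl; simp at hS
  refine ⟨S.roots.toList.length, fun j => S.roots.toList.get j, ?_, fun j => ?_, fun z => ?_⟩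
  · rwa [Multiset.length_toList, IsAlgClosed.card_roots_eq_natDegree]
  · exact isRoot_of_mem_roots (Multiset.mem_toList.1 (List.get_mem _ j))
  · have h := (IsAlgClosed.splits S).eq_prod_roots
    have h2 : S.eval z = S.leadingCoeff * ((S.roots.map fun a => z - a).prod) := by
      conv_lhs => rw [h]
      simp [eval_multiset_prod]
    rw [h2, ← Multiset.coe_toList S.roots, Multiset.map_coe, Multiset.prod_coe, ← List.prod_ofFn]
    congr 2
    apply List.ext_get <;> simp

/-- A zero-free function `F` is, up to the constant `F 0`, approximated by quotients
`q z / q (s z)`. With `q z = ∏ k < m, F (s ^ k z)` the quotient telescopes to `F z / F (s ^ m z)`. -/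
theorem exists_telescoping_quotient {F : ℂ → ℂ} {R : ℝ} (hR : 1 < R)
    (hF : DifferentiableOn ℂ F (ball 0 R)) (hF0 : ∀ z ∈ ball (0 : ℂ) R, F z ≠ 0)
    {s : ℝ} (hs0 : 0 ≤ s) (hs1 : s < 1) {ε : ℝ} (hε : 0 < ε) :
    ∃ q : ℂ → ℂ, DifferentiableOn ℂ q (ball 0 R) ∧ (∀ z ∈ ball (0 : ℂ) R, q z ≠ 0) ∧
      ∀ z ∈ closedBall (0 : ℂ) 1, ‖F z - F 0 * (q z / q (s * z))‖ < ε := by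
  have hsub : closedBall (0 : ℂ) 1 ⊆ ball 0 R := closedBall_subset_ball hR
  have hK : IsCompact (closedBall (0 : ℂ) 1) := isCompact_closedBall _ _
  have hc := hF.continuousOn.mono hsub
  have hmem : ∀ (k : ℕ) (z : ℂ) (ρ : ℝ), ‖z‖ ≤ ρ → ‖(s : ℂ) ^ k * z‖ ≤ ρ := fun k z ρ hz => by
    rw [norm_mul, norm_pow, Complex.norm_real, Real.norm_of_nonneg hs0]
    exact (mul_le_of_le_one_left (norm_nonneg _) (pow_le_one₀ hs0 hs1.le)).trans hz
  have hmemR : ∀ (k : ℕ), ∀ z ∈ ball (0 : ℂ) R, (s : ℂ) ^ k * z ∈ ball (0 : ℂ) R := fun k z hz => by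
    rw [mem_ball_zero_iff] at hz ⊢
    exact (hmem k z _ le_rfl).trans_lt hz
  obtain ⟨κ, hκ, hκ'⟩ := hK.exists_forall_le' (f := fun z => ‖F z‖) (a := 0)
    hc.norm fun z hz => norm_pos_iff.2 (hF0 z (hsub hz))
  obtain ⟨M, hM⟩ := hK.exists_bound_of_continuousOn hc
  have hM0 : 0 ≤ M := (norm_nonneg _).trans (hM 0 (by simp))
  have hc0 : ContinuousAt F 0 :=
    (hF.differentiableAt (ball_mem_nhds _ (by linarith))).continuousAt
  obtain ⟨d, hd, hd'⟩ := Metric.continuousAt_iff.1 hc0 (ε * κ / (M + 1)) (by positivity)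
  obtain ⟨m, hm⟩ := exists_pow_lt_of_lt_one hd hs1
  have hq0 : ∀ z ∈ ball (0 : ℂ) R, ∏ k ∈ Finset.range m, F ((s : ℂ) ^ k * z) ≠ 0 := fun z hz =>
    Finset.prod_ne_zero_iff.2 fun k _ => hF0 _ (hmemR k z hz)
  refine ⟨fun z => ∏ k ∈ Finset.range m, F ((s : ℂ) ^ k * z), ?_, hq0, fun z hz => ?_⟩
  · exact DifferentiableOn.fun_finsetProd fun k _ =>
      hF.comp (by fun_prop) (hmemR k)
  · have hz1 : ‖z‖ ≤ 1 := by simpa using hz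
    have hmz : (s : ℂ) ^ m * z ∈ closedBall (0 : ℂ) 1 := by
      simpa using hmem m z 1 hz1
    have hne := hF0 _ (hsub hmz)
    have hsz : (s : ℂ) * z ∈ ball (0 : ℂ) R := by simpa using hmemR 1 z (hsub hz)
    have htel : (∏ k ∈ Finset.range m, F ((s : ℂ) ^ k * z)) * F ((s : ℂ) ^ m * z) =
        (∏ k ∈ Finset.range m, F ((s : ℂ) ^ k * (s * z))) * F z := by
      rw [← Finset.prod_range_succ (fun k => F ((s : ℂ) ^ k * z)), Finset.prod_range_succ']
      simp [pow_succ, mul_assoc]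
    have hquot : (∏ k ∈ Finset.range m, F ((s : ℂ) ^ k * z)) /
        (∏ k ∈ Finset.range m, F ((s : ℂ) ^ k * (s * z))) = F z / F ((s : ℂ) ^ m * z) := by
      rw [div_eq_div_iff (hq0 _ hsz) hne, htel, mul_comm]
    have hclose : ‖F ((s : ℂ) ^ m * z) - F 0‖ < ε * κ / (M + 1) := by
      rw [← dist_eq_norm]
      refine hd' ?_
      rw [dist_zero_right, norm_mul, norm_pow, Complex.norm_real, Real.norm_of_nonneg hs0]
      exact (mul_le_of_le_one_right (by positivity) hz1).trans_lt hm
    have key : F z - F 0 * (F z / F ((s : ℂ) ^ m * z)) =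
        F z * (F ((s : ℂ) ^ m * z) - F 0) / F ((s : ℂ) ^ m * z) := by field_simp
    have hκz := hκ' _ hmz
    dsimp only
    rw [hquot, key, norm_div, norm_mul, div_lt_iff₀ (hκ.trans_le hκz)]
    calc _ ≤ M * ‖F ((s : ℂ) ^ m * z) - F 0‖ := by gcongr; exact hM z hz
      _ ≤ (M + 1) * ‖F ((s : ℂ) ^ m * z) - F 0‖ := by gcongr; linarith
      _ < (M + 1) * (ε * κ / (M + 1)) := by gcongr
      _ = ε * κ := by field_simp
      _ ≤ _ := by gcongr

/-- Approximation of a zero-free function by the products that finite Blaschke products with zeros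
on a circle `|w| = ρ` become in the coordinate `z = w / ρ`, with `s = ρ ^ 2`. For a polynomial `S` with
roots `b j`, all on the unit circle, such a product is `S z / S (s z)` up to sign. -/
theorem exists_prod_approx_on_unit_disc {F : ℂ → ℂ} {R : ℝ} (hR : 1 < R)
    (hF : DifferentiableOn ℂ F (ball 0 R)) (hF0 : ∀ z ∈ ball (0 : ℂ) R, F z ≠ 0)
    {s : ℝ} (hs0 : 0 ≤ s) (hs1 : s < 1) {r : ℝ} (hr : r < 1) {ε : ℝ} (hε : 0 < ε) :
    ∃ (c : ℂ) (N : ℕ) (b : Fin N → ℂ), 0 < N ∧ (∀ j, ‖b j‖ = 1) ∧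
      ∀ z ∈ closedBall (0 : ℂ) r, ‖F z - c * ∏ j, (z - b j) / (b j - s * z)‖ < ε := by
  have hsub : closedBall (0 : ℂ) 1 ⊆ ball 0 R := closedBall_subset_ball hR
  have hK : IsCompact (closedBall (0 : ℂ) 1) := isCompact_closedBall _ _
  obtain ⟨q, hq, hq0, hqF⟩ := exists_telescoping_quotient hR hF hF0 hs0 hs1 (half_pos hε)
  have hc := hq.continuousOn.mono hsub
  obtain ⟨κ, hκ, hκ'⟩ := hK.exists_forall_le' (f := fun z => ‖q z‖) (a := 0)
    hc.norm fun z hz => norm_pos_iff.2 (hq0 z (hsub hz))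
  obtain ⟨M, hM⟩ := hK.exists_bound_of_continuousOn hc
  have hMpos : 0 < M := hκ.trans_le ((hκ' 0 (by simp)).trans (hM 0 (by simp)))
  set ε' : ℝ := ε / 2 / (‖F 0‖ + 1) with hε'
  have hε'0 : 0 < ε' := by positivity
  obtain ⟨S, hSdeg, hSroot, hSq⟩ := exists_polynomial_roots_on_circle hR hq
    (fun z hz => hq0 z (hsub hz)) hr
    (lt_min (half_pos hκ) (by positivity) : 0 < min (κ / 2) (ε' * κ ^ 2 / (8 * M)))
  obtain ⟨N, b, hN, hb, hSprod⟩ := exists_eval_eq_prod_fin hSdeg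
  refine ⟨F 0 * (-1) ^ N, N, b, hN, fun j => hSroot _ (hb j), fun z hz => ?_⟩
  have hz1 : z ∈ closedBall (0 : ℂ) 1 := closedBall_subset_closedBall hr.le hz
  have hszn : ‖(s : ℂ) * z‖ ≤ ‖z‖ := by
    rw [norm_mul, Complex.norm_real, Real.norm_of_nonneg hs0]
    exact mul_le_of_le_one_left (norm_nonneg _) hs1.le
  have hsz : (s : ℂ) * z ∈ closedBall (0 : ℂ) r := by
    rw [mem_closedBall_zero_iff] at hz ⊢
    exact hszn.trans hz
  have hsz1 := closedBall_subset_closedBall hr.le hsz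
  obtain ⟨hne, hlt⟩ := norm_div_sub_div_lt hκ hMpos hε'0 (hM z hz1) (hM _ hsz1) (hκ' _ hsz1)
    (hSq z hz) (hSq _ hsz)
  have hlead : S.leadingCoeff ≠ 0 := fun h => hne (by rw [hSprod, h, zero_mul])
  have hprod : (-1) ^ N * ∏ j, (z - b j) / (b j - s * z) = S.eval z / S.eval (s * z) := by
    have h1 : ∏ j, (b j - s * z) = (-1) ^ N * ∏ j, (s * z - b j) := by
      have : ((-1 : ℂ)) ^ N = ∏ _j : Fin N, (-1 : ℂ) := by simp
      rw [this, ← Finset.prod_mul_distrib]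
      exact Finset.prod_congr rfl fun j _ => by ring
    have h2 : ((-1 : ℂ)) ^ N ≠ 0 := pow_ne_zero _ (by norm_num)
    rw [Finset.prod_div_distrib, h1, hSprod z, hSprod (s * z), mul_div_mul_left _ _ hlead,
      ← mul_div_assoc, mul_div_mul_left _ _ h2]
  rw [mul_assoc, hprod]
  calc _ = ‖(F z - F 0 * (q z / q (s * z))) -
        F 0 * (S.eval z / S.eval (s * z) - q z / q (s * z))‖ := by ring_nf
    _ ≤ ‖F z - F 0 * (q z / q (s * z))‖ +
        ‖F 0‖ * ‖S.eval z / S.eval (s * z) - q z / q (s * z)‖ := by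
      rw [← norm_mul]; exact norm_sub_le _ _
    _ < ε / 2 + ε / 2 := by
      refine add_lt_add_of_lt_of_le (hqF z hz1) ?_
      calc _ ≤ (‖F 0‖ + 1) * ε' := by gcongr; linarith
        _ = ε / 2 := by rw [hε']; field_simp
    _ = ε := by ring

end

/-! ### Pseudohyperbolic discs and disc automorphisms -/

theorem norm_add_radius_lt_one {a₀ : ℂ} {r₀ : ℝ} (hr₀ : 0 < r₀)
    (hD : closedBall a₀ r₀ ⊆ ball (0 : ℂ) 1) : ‖a₀‖ + r₀ < 1 := by
  rcases eq_or_ne a₀ 0 with rfl | h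
  · have := @hD (r₀ : ℂ) (by simp [abs_of_pos hr₀])
    simpa [abs_of_pos hr₀] using this
  · have hn : 0 < ‖a₀‖ := norm_pos_iff.2 h
    have h1 : ‖(r₀ / ‖a₀‖ : ℝ) • a₀‖ = r₀ := by
      rw [norm_smul, Real.norm_of_nonneg (by positivity)]; field_simp
    -- the point of the closed disc that is farthest from the origin
    have := @hD (a₀ + (r₀ / ‖a₀‖ : ℝ) • a₀)
      (by simp [mem_closedBall, dist_eq_norm, -Complex.real_smul, h1])
    rw [mem_ball_zero_iff] at this
    have h2 : a₀ + (r₀ / ‖a₀‖ : ℝ) • a₀ = (1 + r₀ / ‖a₀‖ : ℝ) • a₀ := by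
      rw [add_smul, one_smul]
    rw [h2, norm_smul, Real.norm_of_nonneg (by positivity)] at this
    calc _ = (1 + r₀ / ‖a₀‖) * ‖a₀‖ := by field_simp
      _ < 1 := this

/-- A disc whose closure lies in the unit disc is a pseudohyperbolic disc
`{z | |z - c| < ρ |1 - conj c * z|}`. The centre `c` is a multiple `t * a₀`, and comparing
coefficients leads to `(t - 1) (1 - |a₀| ^ 2 t) = r₀ ^ 2 t`, which has a root in `(1, 1 / |a₀|)`. -/
theorem exists_pseudohyperbolic_disc {a₀ : ℂ} {r₀ : ℝ} (hr₀ : 0 < r₀) (h : ‖a₀‖ + r₀ < 1) :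
    ∃ (c : ℂ) (ρ κ : ℝ), ‖c‖ < 1 ∧ 0 < ρ ∧ ρ < 1 ∧ 0 < κ ∧ ∀ z : ℂ,
      ‖z - c‖ ^ 2 - ρ ^ 2 * ‖1 - conj c * z‖ ^ 2 = κ * (‖z - a₀‖ ^ 2 - r₀ ^ 2) := by
  rcases eq_or_ne a₀ 0 with rfl | ha
  · exact ⟨0, r₀, 1, by simp, hr₀, by simpa using h, one_pos, fun z => by simp⟩
  have hn : 0 < ‖a₀‖ := norm_pos_iff.2 ha
  have hn1 : ‖a₀‖ < 1 := by linarith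
  set α := ‖a₀‖ with hα
  have hle : (1 : ℝ) ≤ 1 / α := by rw [le_div_iff₀ hn]; linarith
  obtain ⟨t, ht, hroot⟩ := intermediate_value_Ioo hle
    (f := fun t : ℝ => (t - 1) * (1 - α ^ 2 * t) - r₀ ^ 2 * t) (by fun_prop)
    (show (0 : ℝ) ∈ Ioo _ _ from ⟨by simp; positivity, by
      have : (1 / α - 1) * (1 - α ^ 2 * (1 / α)) - r₀ ^ 2 * (1 / α) =
        (1 - α - r₀) * (1 - α + r₀) / α := by field_simp; ring
      rw [this]
      exact div_pos (mul_pos (by linarith) (by linarith)) hn⟩)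
  obtain ⟨ht1, htα⟩ := ht
  dsimp only at hroot
  rw [lt_div_iff₀ hn] at htα
  have hpos1 : 0 < 1 - α ^ 2 * t := by nlinarith
  have ht0 : 0 < t := by linarith
  have htα0 : 0 < t * α := by positivity
  have hpos2 : 0 < 1 - (t * α) ^ 2 := by nlinarith
  -- the square of the pseudohyperbolic radius
  set σ := (t - 1) / (t * (1 - α ^ 2 * t)) with hσ
  have hσ0 : 0 < σ := div_pos (by linarith) (by positivity)
  have hσ1 : σ < 1 := by rw [hσ, div_lt_one (by positivity)]; nlinarith
  have hσeq : σ * (t * (1 - α ^ 2 * t)) = t - 1 :=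
    div_mul_cancel₀ _ (by positivity)
  refine ⟨t * a₀, √σ, 1 - σ * (t * α) ^ 2, ?_, Real.sqrt_pos.2 hσ0, ?_, ?_, fun z => ?_⟩
  · rw [norm_mul, Complex.norm_real, Real.norm_of_nonneg ht0.le]; exact htα
  · rw [Real.sqrt_lt' one_pos]; simpa using hσ1
  · nlinarith
  · rw [Real.sq_sqrt hσ0.le]
    have hα2 : α ^ 2 = a₀.re ^ 2 + a₀.im ^ 2 := by
      rw [hα, ← Complex.normSq_eq_norm_sq, Complex.normSq_apply]; ring
    simp only [← Complex.normSq_eq_norm_sq, Complex.normSq_apply, Complex.sub_re, Complex.sub_im,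
      Complex.mul_re, Complex.mul_im, map_mul, Complex.conj_re, Complex.conj_im, Complex.one_re,
      Complex.one_im, Complex.ofReal_re, Complex.ofReal_im, Complex.conj_ofReal]
    -- the coefficients of `z`, and then the constant terms, agree
    have e1 : (1 - σ) * t = 1 - σ * (t * α) ^ 2 := by linear_combination (-1 : ℝ) * hσeq
    have e2 : (t * α) ^ 2 - σ = (1 - σ * (t * α) ^ 2) * (α ^ 2 - r₀ ^ 2) := by
      have hr : r₀ ^ 2 = σ * (1 - α ^ 2 * t) ^ 2 := by
        refine mul_right_cancel₀ ht0.ne' ?_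
        linear_combination (-1 : ℝ) * hroot - (1 - α ^ 2 * t) * hσeq
      rw [hr, ← e1]
      linear_combination ((1 - σ) * (1 - α ^ 2 * t) - 1) * hσeq
    rw [mul_pow, hα2] at e1 e2 ⊢
    linear_combination (-2 * (a₀.re * z.re + a₀.im * z.im)) * e1 + e2

/-- The automorphism `z ↦ (z - c) / (1 - conj c * z)` of the unit disc; its inverse is
`discAut (-c)`. -/
noncomputable def discAut (c z : ℂ) : ℂ := (z - c) / (1 - conj c * z)

theorem one_sub_conj_mul_discAut {c b z : ℂ} (hb : 1 - conj c * b ≠ 0) (hz : 1 - conj c * z ≠ 0) :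
    1 - conj (discAut c b) * discAut c z =
      (1 - conj c * c) * (1 - conj b * z) / (conj (1 - conj c * b) * (1 - conj c * z)) := by
  have hb' : conj (1 - conj c * b) ≠ 0 := (map_ne_zero _).2 hb
  rw [discAut, discAut, map_div₀, div_mul_div_comm, eq_div_iff (mul_ne_zero hb' hz), sub_mul,
    div_mul_cancel₀ _ (mul_ne_zero hb' hz)]
  simp only [map_sub, map_one, map_mul, Complex.conj_conj]
  ring

theorem discAut_sub_discAut {c b z : ℂ} (hb : 1 - conj c * b ≠ 0) (hz : 1 - conj c * z ≠ 0) :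
    discAut c z - discAut c b =
      (1 - conj c * c) * (z - b) / ((1 - conj c * b) * (1 - conj c * z)) := by
  rw [discAut, discAut, div_sub_div _ _ hz hb, div_eq_div_iff (mul_ne_zero hz hb)
    (mul_ne_zero hb hz)]
  ring

theorem norm_discAut_lt_one {c z : ℂ} (hc : ‖c‖ < 1) (hz : ‖z‖ < 1) : ‖discAut c z‖ < 1 := by
  have hne := one_sub_conj_mul_ne_zero hc.le hz
  have h := one_sub_conj_mul_discAut hne hne
  have e : ∀ w : ℂ, 1 - conj w * w = ((1 - ‖w‖ ^ 2 : ℝ) : ℂ) := fun w => by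
    rw [mul_comm, Complex.mul_conj, Complex.normSq_eq_norm_sq]; push_cast; ring
  rw [e, e, e, mul_comm (conj _), Complex.mul_conj] at h
  norm_cast at h
  have : 0 < 1 - ‖discAut c z‖ ^ 2 := by
    rw [h]
    have := Complex.normSq_pos.2 hne
    have h1 : 0 < 1 - ‖c‖ ^ 2 := by nlinarith [norm_nonneg c]
    have h2 : 0 < 1 - ‖z‖ ^ 2 := by nlinarith [norm_nonneg z]
    positivity
  nlinarith [norm_nonneg (discAut c z)]

theorem discAut_neg_discAut {c z : ℂ} (hc : ‖c‖ < 1) (hz : ‖z‖ < 1) :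
    discAut c (discAut (-c) z) = z := by
  have hne := one_sub_conj_mul_ne_zero (a := -c) (by simpa using hc.le) hz
  have hcc := one_sub_conj_mul_ne_zero hc.le hc
  simp only [map_neg, neg_mul, sub_neg_eq_add] at hne
  have h1 : (z + c) / (1 + conj c * z) - c = (1 - conj c * c) * z / (1 + conj c * z) := by
    rw [div_sub' hne]; congr 1; ring
  have h2 : 1 - conj c * ((z + c) / (1 + conj c * z)) =
      (1 - conj c * c) / (1 + conj c * z) := by
    rw [← mul_div_assoc, one_sub_div hne]; congr 1; ring
  simp only [discAut, map_neg, neg_mul, sub_neg_eq_add]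
  rw [h1, h2, div_div_div_cancel_right₀ hne, mul_div_cancel_left₀ _ hcc]

theorem differentiableOn_discAut {c : ℂ} (hc : ‖c‖ < 1) :
    DifferentiableOn ℂ (discAut c) (ball 0 1) :=
  DifferentiableOn.div (by fun_prop) (by fun_prop) fun z hz =>
    one_sub_conj_mul_ne_zero hc.le (by simpa using hz)

/-- A zero-free analytic function on the disc is approximated by constant multiples of finite
Blaschke products with zeros on the given circle. The automorphism `discAut c` carries the circle to
a circle about `0`, and changes Blaschke factors only by unimodular constants. -/
theorem exists_blaschke_approx {a₀ : ℂ} {r₀ : ℝ} (hr₀ : 0 < r₀)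
    (hD : closedBall a₀ r₀ ⊆ ball (0 : ℂ) 1) {g : ℂ → ℂ} (hg : DifferentiableOn ℂ g (ball 0 1))
    (hg0 : ∀ z ∈ ball (0 : ℂ) 1, g z ≠ 0) {δ ε : ℝ} (hδ : 0 < δ) (hε : 0 < ε) :
    ∃ (c : ℂ) (N : ℕ) (b : Fin N → ℂ), 0 < N ∧ (∀ j, b j ∈ sphere a₀ r₀) ∧
      ∀ z ∈ ball a₀ (r₀ - δ), ‖g z - c * ∏ j, (z - b j) / (1 - conj (b j) * z)‖ < ε := by
  obtain ⟨c, ρ, κ, hc, hρ0, hρ1, hκ, hdisc⟩ :=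
    exists_pseudohyperbolic_disc hr₀ (norm_add_radius_lt_one hr₀ hD)
  have hc' : ‖-c‖ < 1 := by simpa using hc
  have hρC : (ρ : ℂ) ≠ 0 := by exact_mod_cast hρ0.ne'
  have hne : ∀ z : ℂ, ‖z‖ < 1 → 1 - conj c * z ≠ 0 := fun z hz =>
    one_sub_conj_mul_ne_zero hc.le hz
  have hid : ∀ z : ℂ, ‖z‖ < 1 → (‖discAut c z‖ ^ 2 - ρ ^ 2) * ‖1 - conj c * z‖ ^ 2 =
      κ * (‖z - a₀‖ ^ 2 - r₀ ^ 2) := fun z hz => by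
    have h1 : ‖1 - conj c * z‖ ≠ 0 := norm_ne_zero_iff.2 (hne z hz)
    rw [← hdisc z, discAut, norm_div, sub_mul, ← mul_pow, div_mul_cancel₀ _ h1]
  have hsubK : closedBall a₀ (r₀ - δ) ⊆ ball (0 : ℂ) 1 :=
    (closedBall_subset_closedBall (by linarith)).trans hD
  -- the smaller disc lies in a strictly smaller pseudohyperbolic disc
  obtain ⟨r, hr1, hr⟩ : ∃ r < 1, ∀ z ∈ closedBall a₀ (r₀ - δ), ‖discAut c z / ρ‖ ≤ r := by
    suffices h : ∀ z ∈ closedBall a₀ (r₀ - δ), -1 < -‖discAut c z / ρ‖ by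
      obtain ⟨r, hr, hr'⟩ := (isCompact_closedBall a₀ (r₀ - δ)).exists_forall_le'
        (((differentiableOn_discAut hc).continuousOn.mono hsubK).div_const _).norm.neg h
      exact ⟨-r, by linarith, fun z hz => le_neg_of_le_neg (hr' z hz)⟩
    refine fun z hz => neg_lt_neg ?_
    have hz1 : ‖z‖ < 1 := by simpa using hsubK hz
    have h1 : 0 < ‖1 - conj c * z‖ ^ 2 := by have := norm_pos_iff.2 (hne z hz1); positivity
    have h2 : ‖z - a₀‖ ≤ r₀ - δ := by simpa [dist_eq_norm] using hz
    have h3 : κ * (‖z - a₀‖ ^ 2 - r₀ ^ 2) < 0 :=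
      mul_neg_of_pos_of_neg hκ (by nlinarith [norm_nonneg (z - a₀)])
    rw [← hid z hz1] at h3
    have h4 := neg_of_mul_neg_left h3 h1.le
    rw [norm_div, Complex.norm_real, Real.norm_of_nonneg hρ0.le, div_lt_one hρ0]
    exact lt_of_pow_lt_pow_left₀ 2 hρ0.le (by linarith)
  have hmaps : ∀ ζ ∈ ball (0 : ℂ) (1 / ρ), (ρ : ℂ) * ζ ∈ ball (0 : ℂ) 1 := fun ζ hζ => by
    rw [mem_ball_zero_iff, lt_div_iff₀ hρ0] at hζ
    rwa [mem_ball_zero_iff, norm_mul, Complex.norm_real, Real.norm_of_nonneg hρ0.le, mul_comm]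
  have hmaps2 : ∀ w ∈ ball (0 : ℂ) 1, discAut (-c) w ∈ ball (0 : ℂ) 1 := fun w hw => by
    rw [mem_ball_zero_iff] at hw ⊢
    exact norm_discAut_lt_one hc' hw
  obtain ⟨k, N, β, hN, hβ, hk⟩ := exists_prod_approx_on_unit_disc
    (F := fun ζ => g (discAut (-c) (ρ * ζ))) (R := 1 / ρ) (by rwa [lt_div_iff₀ hρ0, one_mul])
    (hg.comp ((differentiableOn_discAut hc').comp (by fun_prop) hmaps)
      fun ζ hζ => hmaps2 _ (hmaps ζ hζ))
    (fun ζ hζ => hg0 _ (hmaps2 _ (hmaps ζ hζ))) (sq_nonneg ρ) (by nlinarith) hr1 hε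
  set b : Fin N → ℂ := fun j => discAut (-c) (ρ * β j) with hb
  have hρβ : ∀ j, ‖(ρ : ℂ) * β j‖ = ρ := fun j => by
    rw [norm_mul, hβ, Complex.norm_real, Real.norm_of_nonneg hρ0.le, mul_one]
  have hb1 : ∀ j, ‖b j‖ < 1 := fun j => norm_discAut_lt_one hc' ((hρβ j).trans_lt hρ1)
  have hφb : ∀ j, discAut c (b j) = ρ * β j := fun j =>
    discAut_neg_discAut hc ((hρβ j).trans_lt hρ1)
  refine ⟨k * ∏ j, (ρ * β j)⁻¹ * (conj (1 - conj c * b j) / (1 - conj c * b j)), N, b, hN,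
    fun j => ?_, fun z hz => ?_⟩
  · have h1 := hid (b j) (hb1 j)
    rw [hφb, hρβ, sub_self, zero_mul, eq_comm, mul_eq_zero, or_iff_right hκ.ne', sub_eq_zero] at h1
    rw [mem_sphere_iff_norm]
    exact (pow_left_inj₀ (norm_nonneg _) hr₀.le two_ne_zero).1 h1
  · have hzc := ball_subset_closedBall hz
    have hz1 : ‖z‖ < 1 := by simpa using hsubK hzc
    have h1 := hk (discAut c z / ρ) (by simpa using hr z hzc)
    have hback : discAut (-c) (discAut c z) = z := by
      simpa using discAut_neg_discAut (c := -c) hc' hz1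
    rw [mul_div_cancel₀ _ hρC, hback] at h1
    convert h1 using 3
    rw [mul_assoc, ← Finset.prod_mul_distrib]
    congr 1
    refine Finset.prod_congr rfl fun j _ => ?_
    have hzb := hne z hz1
    have hbb := hne (b j) (hb1 j)
    have hcc := hne c hc
    have hcb : conj (1 - conj c * b j) ≠ 0 := (map_ne_zero _).2 hbb
    have hββ : β j * conj (β j) = 1 := by
      rw [Complex.mul_conj, Complex.normSq_eq_norm_sq, hβ]; simp
    have e1 := discAut_sub_discAut hbb hzb
    have e2 := one_sub_conj_mul_discAut hbb hzb
    have e3 : (discAut c z / ρ - β j) / (β j - (ρ ^ 2 : ℝ) * (discAut c z / ρ)) =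
        (ρ * β j)⁻¹ * ((discAut c z - discAut c (b j)) /
          (1 - conj (discAut c (b j)) * discAut c z)) := by
      have n1 : discAut c z / ρ - β j = (discAut c z - ρ * β j) / ρ := by field_simp
      have n2 : β j - (ρ ^ 2 : ℝ) * (discAut c z / ρ) =
          (ρ * β j) * (1 - conj (ρ * β j) * discAut c z) / ρ := by
        rw [eq_div_iff hρC, map_mul, Complex.conj_ofReal]
        push_cast
        field_simp
        linear_combination (discAut c z * ρ) * hββ
      rw [hφb, n1, n2, div_div_div_cancel_right₀ hρC, div_mul_eq_div_div_swap,
        div_eq_mul_inv _ (ρ * β j : ℂ), mul_comm]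
    rw [e3, e1, e2, mul_assoc]
    congr 1
    generalize conj (1 - conj c * b j) = B' at *
    generalize 1 - conj c * b j = B at *
    generalize 1 - conj c * z = Z at *
    generalize 1 - conj c * c = K at *
    generalize 1 - conj (b j) * z = D
    field_simp

/-! ### Approximation of Hardy space functions -/

theorem corollary3p3 (p : ℝ) (hp : 0 < p) (f : ℂ → ℂ) (hf : MemHardy p f)
    (hf0 : ∃ z ∈ ball (0 : ℂ) 1, f z ≠ 0)
    (a₀ : ℂ) (r₀ : ℝ) (hr₀ : 0 < r₀) (hD : closedBall a₀ r₀ ⊆ ball (0 : ℂ) 1) :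
    ∃ C₁ : ℂ → ℂ, IsBlaschkeFactor f C₁ ∧
      ∀ δ > (0 : ℝ), ∀ ε > (0 : ℝ),
        ∃ (c₀ : ℂ) (C₂ : ℂ → ℂ) (N : ℕ) (b : Fin N → ℂ),
          0 < N ∧ (∀ j, b j ∈ sphere a₀ r₀) ∧ IsFiniteBlaschkeProduct b C₂ ∧
          ∀ z ∈ ball a₀ (r₀ - δ), ‖f z - c₀ * C₁ z * C₂ z‖ < ε := by
  obtain ⟨A, hA⟩ := hf.exists_circleAverage_log_le hp
  have hb := isBlaschkeFamily_zeroFamily hf.1 hf0 hA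
  obtain ⟨g, hg, hg0, hfg⟩ := exists_eq_blaschkeProduct_mul hf.1 hf0 hb
  refine ⟨fun z => ∏' i, blaschkeTerm (zeroFamily f i) z, ⟨hb, fun z hz => hb.hasProd hz⟩,
    fun δ hδ ε hε => ?_⟩
  obtain ⟨M, hM⟩ := (isCompact_closedBall a₀ r₀).exists_bound_of_continuousOn
    (hb.differentiableOn_tprod.continuousOn.mono hD)
  have hM0 : 0 ≤ M := (norm_nonneg _).trans (hM a₀ (mem_closedBall_self hr₀.le))
  obtain ⟨c, N, b, hN, hbs, happ⟩ :=
    exists_blaschke_approx hr₀ hD hg hg0 hδ (div_pos hε (by linarith : 0 < M + 1))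
  refine ⟨c, fun z => ∏ j, (z - b j) / (1 - conj (b j) * z), N, b, hN, hbs,
    ⟨fun j => by simpa using hD (sphere_subset_closedBall (hbs j)), 1, norm_one,
      fun z _ => (one_mul _).symm⟩, fun z hz => ?_⟩
  have hzD : z ∈ closedBall a₀ r₀ :=
    (ball_subset_closedBall.trans (closedBall_subset_closedBall (by linarith))) hz
  have key : ∀ P B : ℂ, B * g z - c * B * P = B * (g z - c * P) := fun P B => by ring
  rw [hfg z (hD hzD), key, norm_mul]
  calc _ ≤ (M + 1) * ‖g z - c * ∏ j, (z - b j) / (1 - conj (b j) * z)‖ := by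
        gcongr; exact (hM z hzD).trans (by linarith)
    _ < (M + 1) * (ε / (M + 1)) := by gcongr; exact happ z hz
    _ = ε := by field_simp
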